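/- Let $\mathcal H$ be a finite-dimensional complex Hilbert space. An observable on $\mathcal H$ is a map $\mathsf A$ from a finite set $\Omega$ to the positive operators on $\mathcal H$ with $\sum_{\omega}\mathsf A(\omega)=\mathbb 1$. A channel is a completely positive trace-preserving linear map $\Lambda:\mathcal L(\mathcal H)\to\mathcal L(\mathcal K)$, with $\mathcal K$ any finite-dimensional complex Hilbert space. Let $\mathcal O$ and $\mathcal C$ denote the collections of all observables and all channels on $\mathcal H$. An observable $\mathsf A$ and a channel $\Lambda$ are compatible if there are completely positive maps $\mathcal I_\omega:\mathcal L(\mathcal H)\to\mathcal L(\mathcal K)$, $\omega\in\Omega$, with $\sum_\omega\mathcal I_\omega=\Lambda$ and $\operatorname{tr}[T\,\mathsf A(\omega)]=\operatorname{tr}[\mathcal I_\omega(T)]$ for all $\omega\in\Omega$ and $T\in\mathcal L(\mathcal H)$. For $X\subseteq\mathcal O$, let $\sigma_c(X)$ be the set of channels compatible with every $\mathsf A\in X$, and for $Y\subseteq\mathcal C$ let $\tau_c(Y)$ be the set of observables compatible with every $\Lambda\in Y$. Put $\mathrm{leak}(X)=\tau_c(\sigma_c(X))$. For an observable $\mathsf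 B$ with outcome set $\Omega$ and a stochastic matrix $\mu$ (that is, $\mu(\omega',\omega)\ge 0$ and $\sum_{\omega'}\mu(\omega',\omega)=1$), put $(\mu\circ\mathsf B)(\omega')=\sum_\omega\mu(\omega',\omega)\mathsf B(\omega)$. Let $\mathrm{sim}_{\mathcal O}(X)$ be the set of all observables of the form $\sum_{i=1}^n t_i\,\mu_i\circ\mathsf A_i$ with $\mathsf A_i\in X$, stochastic matrices $\mu_i$, $t_i\in[0,1]$ and $\sum_i t_i=1$; write $\mathrm{sim}_{\mathcal O}(\mathsf A)=\mathrm{sim}_{\mathcal O}(\{\mathsf A\})$. The observables in $X$ are jointly measurable if there is an observable $\mathsf G$ such that every $\mathsf A\in X$ is of the form $\mu\circ\mathsf G$ with $\mu$ a stochastic matrix. Let $\mathcal H=\mathbb C^3$, let $\{|n\rangle\}_{n=1,2,3}$ be any orthonormal basis, and put $\mathsf E(n)=|n\rangle\langle n|$ for $n=1,2,3$. Let $\mathsf A$ and $\mathsf B$ be the two-outcome observables with $$\mathsf A(1)=\mathsf E(1),\quad \mathsf A(2)=\mathsf E(2)+\mathsf E(3),\qquad \mathsf B(1)=\mathsf E(1)+\mathsf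 E(2),\quad \mathsf B(2)=\mathsf E(3).$$ Then $\mathsf A$ and $\mathsf B$ are jointly measurable and $$\mathrm{leak}(\{\mathsf A,\mathsf B\})=\mathrm{sim}_{\mathcal O}(\mathsf E)\neq\mathrm{sim}_{\mathcal O}(\{\mathsf A,\mathsf B\}).$$ Consequently, it is not true that $\mathrm{leak}(X)=\mathrm{sim}_{\mathcal O}(X)$ for every set $X$ of jointly measurable observables on $\mathbb C^3$. -/

import Mathlib

open scoped CStarAlgebra

noncomputable section

namespace QLeak

/-- The trace of an operator on a finite-dimensional Hilbert space. -/
def opTrace {H : Type*} [NormedAddCommGroup H] [InnerProductSpace ℂ H] (T : H →L[ℂ] H) : ℂ :=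
  LinearMap.trace ℂ H (T : H →ₗ[ℂ] H)

/-- An observable on `H`: an outcome set `Ω`, which may be any finite set, together with positive
operators indexed by `Ω` that sum up to the identity operator. -/
structure Observable (H : Type*) [NormedAddCommGroup H] [InnerProductSpace ℂ H]
    [FiniteDimensional ℂ H] where
  Ω : Type
  [fintypeΩ : Fintype Ω]
  effect : Ω → (H →L[ℂ] H)
  isPositive : ∀ ω, (effect ω).IsPositive
  sum_eq_one : ∑ ω, effect ω = 1

attribute [instance] Observable.fintypeΩ

/-- A channel on `H`: an output space `K`, which may be any finite-dimensional complex Hilbert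
space, together with a completely positive trace-preserving map `L(H) → L(K)`. -/
structure Channel (H : Type*) [NormedAddCommGroup H] [InnerProductSpace ℂ H]
    [FiniteDimensional ℂ H] [CompleteSpace H] where
  K : Type
  [normedK : NormedAddCommGroup K]
  [innerK : InnerProductSpace ℂ K]
  [finiteK : FiniteDimensional ℂ K]
  [completeK : CompleteSpace K]
  map : (H →L[ℂ] H) →CP (K →L[ℂ] K)
  trace_map : ∀ T : H →L[ℂ] H, opTrace (map T) = opTrace T

attribute [instance] Channel.normedK Channel.innerK Channel.finiteK Channel.completeK

/-- An instrument with outcome set `Ω` and output space `K`: completely positive maps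
`op ω : L(H) → L(K)` whose sum is trace-preserving (hence a channel, since a sum of completely
positive maps is completely positive). -/
structure Instrument (Ω : Type) [Fintype Ω]
    (H : Type*) [NormedAddCommGroup H] [InnerProductSpace ℂ H]
    [FiniteDimensional ℂ H] [CompleteSpace H]
    (K : Type*) [NormedAddCommGroup K] [InnerProductSpace ℂ K]
    [FiniteDimensional ℂ K] [CompleteSpace K] where
  op : Ω → ((H →L[ℂ] H) →CP (K →L[ℂ] K))
  trace_sum : ∀ T : H →L[ℂ] H, opTrace (∑ ω, op ω T) = opTrace T

section Compatibility

variable {H : Type*} [NormedAddCommGroup H] [InnerProductSpace ℂ H]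
  [FiniteDimensional ℂ H] [CompleteSpace H]

/-- `A` and `Λ` are compatible: some instrument has associated channel `Λ`, that is
`∑ ω, I_ω = Λ`, and associated observable `A`, that is `tr (T A(ω)) = tr (I_ω(T))`. -/
def Compatible (A : Observable H) (Λ : Channel H) : Prop :=
  ∃ I : Instrument A.Ω H Λ.K,
    (∀ T : H →L[ℂ] H, ∑ ω, I.op ω T = Λ.map T) ∧
    (∀ (ω : A.Ω) (T : H →L[ℂ] H), opTrace (T * A.effect ω) = opTrace (I.op ω T))

/-- The channels compatible with every observable in `X`. -/
def sigmaC (X : Set (Observable H)) : Set (Channel H) :=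
  {Λ | ∀ A ∈ X, Compatible A Λ}

/-- The observables compatible with every channel in `Y`. -/
def tauC (Y : Set (Channel H)) : Set (Observable H) :=
  {A | ∀ Λ ∈ Y, Compatible A Λ}

/-- The leak closure. -/
def leak (X : Set (Observable H)) : Set (Observable H) :=
  tauC (sigmaC X)

end Compatibility

/-- `μ ω' ω` is the probability of passing from `ω` to `ω'`. -/
def IsStochastic {Ω' Ω : Type} [Fintype Ω'] (μ : Ω' → Ω → ℝ) : Prop :=
  (∀ ω' ω, 0 ≤ μ ω' ω) ∧ ∀ ω, ∑ ω', μ ω' ω = 1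

section Simulability

variable {H : Type*} [NormedAddCommGroup H] [InnerProductSpace ℂ H] [FiniteDimensional ℂ H]

/-- `(μ ∘ B)(ω') = ∑ ω, μ(ω', ω) B(ω)`. -/
def postProcess {Ω' : Type} (B : Observable H) (μ : Ω' → B.Ω → ℝ) (ω' : Ω') : H →L[ℂ] H :=
  ∑ ω, (μ ω' ω : ℂ) • B.effect ω

/-- The post-processing preorder on observables, `A ≼ B`. -/
def PostProcessing (A B : Observable H) : Prop :=
  ∃ μ : A.Ω → B.Ω → ℝ, IsStochastic μ ∧ ∀ ω', A.effect ω' = postProcess B μ ω'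

/-- `X'` is simulable by `X`: every observable in `X'` is a convex combination of post-processings
of finitely many observables in `X`. -/
def Simulable (X' X : Set (Observable H)) : Prop :=
  ∀ A' ∈ X', ∃ (n : ℕ) (A : Fin n → Observable H) (μ : ∀ i, A'.Ω → (A i).Ω → ℝ) (t : Fin n → ℝ),
    (∀ i, A i ∈ X) ∧ (∀ i, IsStochastic (μ i)) ∧
    (∀ i, t i ∈ Set.Icc (0 : ℝ) 1) ∧ ∑ i, t i = 1 ∧
    ∀ ω', A'.effect ω' = ∑ i, (t i : ℂ) • postProcess (A i) (μ i) ω'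

/-- The set of all observables simulable by `X`. -/
def simO (X : Set (Observable H)) : Set (Observable H) :=
  {A | Simulable {A} X}

/-- The observables in `X` are jointly measurable: they are all post-processings of a single
observable. -/
def JointlyMeasurable (X : Set (Observable H)) : Prop :=
  ∃ G : Observable H, ∀ A ∈ X, PostProcessing A G

end Simulability

section Qutrit

/-- The Hilbert space `ℂ³`. -/
abbrev Qutrit : Type := EuclideanSpace ℂ (Fin 3)

/-- The projection `|n⟩⟨n|` onto a vector of an orthonormal basis. -/
def basisProj (b : OrthonormalBasis (Fin 3) ℂ Qutrit) (n : Fin 3) : Qutrit →L[ℂ] Qutrit :=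
  InnerProductSpace.rankOne ℂ (b n) (b n)

theorem basisProj_isPositive (b : OrthonormalBasis (Fin 3) ℂ Qutrit) (n : Fin 3) :
    (basisProj b n).IsPositive :=
  InnerProductSpace.isPositive_rankOne_self (b n)

theorem basisProj_sum (b : OrthonormalBasis (Fin 3) ℂ Qutrit) : ∑ n, basisProj b n = 1 :=
  b.sum_rankOne_eq_id

/-- The sharp observable `E` of an orthonormal basis, `E(n) = |n⟩⟨n|`. -/
def obsE (b : OrthonormalBasis (Fin 3) ℂ Qutrit) : Observable Qutrit where
  Ω := Fin 3
  effect := basisProj b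
  isPositive := basisProj_isPositive b
  sum_eq_one := basisProj_sum b

/-- The two-outcome coarse-graining `{E(1), E(2) + E(3)}` of `E`. -/
def obsA (b : OrthonormalBasis (Fin 3) ℂ Qutrit) : Observable Qutrit where
  Ω := Fin 2
  effect := ![basisProj b 0, basisProj b 1 + basisProj b 2]
  isPositive := by
    intro ω
    fin_cases ω
    · exact basisProj_isPositive b 0
    · exact (basisProj_isPositive b 1).add (basisProj_isPositive b 2)
  sum_eq_one := by
    rw [← basisProj_sum b, Fin.sum_univ_two, Fin.sum_univ_three, add_assoc]
    rfl

/-- The two-outcome coarse-graining `{E(1) + E(2), E(3)}` of `E`. -/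
def obsB (b : OrthonormalBasis (Fin 3) ℂ Qutrit) : Observable Qutrit where
  Ω := Fin 2
  effect := ![basisProj b 0 + basisProj b 1, basisProj b 2]
  isPositive := by
    intro ω
    fin_cases ω
    · exact (basisProj_isPositive b 0).add (basisProj_isPositive b 1)
    · exact basisProj_isPositive b 2
  sum_eq_one := by
    rw [← basisProj_sum b, Fin.sum_univ_two, Fin.sum_univ_three]
    rfl

end Qutrit

end QLeak

end

/-!
The proof rests on the Cauchy–Schwarz inequality for positive maps: if `Φ` is positive and
`Φ (s* s) = 0`, then `Φ (s* t) = 0` and `Φ (t s) = 0` for all `t` (`map_star_mul_eq_zero`,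
`map_mul_eq_zero`).

*Disturbance caused by `A` and `B`.* Let `Λ` be a channel compatible with an observable through an
instrument `I`. If `E(n) A(ω) = 0`, then `I_ω(E(n))` is a positive operator with trace
`tr (E(n) A(ω)) = 0`, hence it vanishes, and by Cauchy–Schwarz so do `I_ω(E(n) T)` and
`I_ω(T E(n))`. Therefore `Λ(E(m) T E(n)) = 0` whenever every effect of the observable is annihilated
by `E(m)` or by `E(n)`. Any two distinct indices are separated in this sense by `A` or by `B`, so a
channel compatible with both satisfies `Λ(T) = ∑ n, Λ(E(n) T E(n))` (`channel_eq_pinched`). For such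
a channel the maps `T ↦ ∑ n, ν(ω, n) Λ(E(n) T E(n))` form an instrument measuring any given
post-processing `∑ n, ν(ω, n) E(n)` of `E` (`compatible_of_pinched`). So the observables simulable
by `E` leak.

*Nothing else leaks.* The Lüders channel `T ↦ ∑ n, E(n) T E(n)` is itself compatible with `A` and
`B`. If `I` is an instrument for it, the functional `T ↦ ⟨n| I_ω(T) |n⟩` vanishes at `E(m)` for
`m ≠ n`, so by Cauchy–Schwarz it is a multiple of `T ↦ ⟨n| T |n⟩`; taking traces, the measured
observable is a post-processing of `E` (`postProcessing_of_compatible_luedersChannel`).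

*`E` is not simulable by `A` and `B`.* An effect `F` of a post-processing of `A` or of `B` satisfies
`⟨2|F|2⟩ ≤ ⟨1|F|1⟩ + ⟨3|F|3⟩`, because neither `A` nor `B` distinguishes the middle vector from
both of its neighbours. The inequality survives convex combinations and fails for `F = E(2)`
(`obsE_notMem_simO`).

Here the basis is numbered from `1` to `3`; the Lean index of the `n`-th basis vector is `n - 1`.
-/

namespace QLeak

open scoped CStarAlgebra InnerProductSpace ComplexOrder

/-! ### Positive and completely positive maps -/

section PositiveMaps

variable {A B : Type*} [CStarAlgebra A] [PartialOrder A] [StarOrderedRing A]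
  [CStarAlgebra B] [PartialOrder B] [StarOrderedRing B]

/-- This is the Cauchy–Schwarz inequality in the GNS space of `f`. -/
theorem functional_star_mul_eq_zero (f : A →ₚ[ℂ] ℂ) {s : A} (hs : f (star s * s) = 0) (t : A) :
    f (star s * t) = 0 := by
  have h := norm_inner_le_norm (𝕜 := ℂ) (f.toPreGNS s) (f.toPreGNS t)
  rw [f.preGNS_norm_def, f.preGNS_inner_def] at h
  simpa [hs] using h

/-- The completely positive map `T ↦ ∑ i, c i • Φ (s i* T s i)`, for a completely positive map `Φ`
and nonnegative weights `c`. -/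
noncomputable def weightedCompression {ι : Type*} [Fintype ι] (Φ : A →CP B) (c : ι → ℝ)
    (hc : ∀ i, 0 ≤ c i) (s : ι → A) : A →CP B where
  toFun T := ∑ i, (c i : ℂ) • Φ (star (s i) * T * s i)
  map_add' T T' := by simp [mul_add, add_mul, Finset.sum_add_distrib]
  map_smul' z T := by
    simp only [mul_smul_comm, smul_mul_assoc, map_smul, RingHom.id_apply, Finset.smul_sum]
    exact Finset.sum_congr rfl fun i _ => smul_comm _ _ _
  map_cstarMatrix_nonneg' k M hM := by
    classical
    -- Entrywise compression by `s i` is compression of the matrix by the diagonal matrix of `s i`.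
    let D : ι → CStarMatrix (Fin k) (Fin k) A := fun i =>
      CStarMatrix.ofMatrix (Matrix.diagonal fun _ => s i)
    have hD (i : ι) (p q : Fin k) : (star (D i) * M * D i) p q = star (s i) * M p q * s i := by
      simp [D, CStarMatrix.mul_apply, CStarMatrix.star_apply, Matrix.diagonal_apply,
        apply_ite star]
    have key : 0 ≤ ∑ i, c i • (star (D i) * M * D i).map Φ :=
      Finset.sum_nonneg fun i _ => smul_nonneg (hc i)
        (Φ.map_cstarMatrix_nonneg _ (star_left_conjugate_nonneg hM (D i)))
    convert key using 1
    ext p q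
    have happ (N : ι → CStarMatrix (Fin k) (Fin k) B) : (∑ i, N i) p q = ∑ i, N i p q :=
      map_sum (AddMonoidHom.mk' (fun N : CStarMatrix (Fin k) (Fin k) B => N p q) fun _ _ => rfl) _ _
    simp [happ, hD]

end PositiveMaps

section MapsIntoOperators

variable {H : Type*} [NormedAddCommGroup H] [InnerProductSpace ℂ H] [CompleteSpace H]
  {A : Type*} [CStarAlgebra A] [PartialOrder A] [StarOrderedRing A]

/-- The positive functional `a ↦ ⟪x, Φ a x⟫`. -/
noncomputable def vectorFunctional (Φ : A →CP (H →L[ℂ] H)) (x : H) : A →ₚ[ℂ] ℂ :=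
  .mk₀ (((innerSL ℂ x).toLinearMap ∘ₗ LinearMap.applyₗ x) ∘ₗ ContinuousLinearMap.coeLM ℂ ∘ₗ
    (Φ : A →ₗ[ℂ] (H →L[ℂ] H))) (by
    intro a ha
    have : 0 ≤ Φ a := map_nonneg Φ ha
    exact ((ContinuousLinearMap.nonneg_iff_isPositive _).1 this).inner_nonneg_right x)

@[simp] theorem vectorFunctional_apply (Φ : A →CP (H →L[ℂ] H)) (x : H) (a : A) :
    vectorFunctional Φ x a = ⟪x, Φ a x⟫_ℂ := rfl

theorem map_star_mul_eq_zero (Φ : A →CP (H →L[ℂ] H)) {s : A} (hs : Φ (star s * s) = 0) (t : A) :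
    Φ (star s * t) = 0 := by
  have h (x : H) : ⟪x, Φ (star s * t) x⟫_ℂ = 0 :=
    functional_star_mul_eq_zero (vectorFunctional Φ x) (by simp [hs]) t
  apply ContinuousLinearMap.coe_injective
  refine (inner_map_self_eq_zero (Φ (star s * t) : H →ₗ[ℂ] H)).1 fun x => ?_
  rw [← inner_conj_symm]
  exact (congrArg _ (h x)).trans (map_zero _)

theorem map_mul_eq_zero (Φ : A →CP (H →L[ℂ] H)) {s : A} (hs : Φ (star s * s) = 0) (t : A) :
    Φ (t * s) = 0 := by
  have := map_star_mul_eq_zero Φ hs (star t)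
  rw [← star_mul, map_star] at this
  simpa using this

end MapsIntoOperators

/-! ### The trace -/

section Trace

variable {H : Type*} [NormedAddCommGroup H] [InnerProductSpace ℂ H]

theorem opTrace_eq_sum_inner {ι : Type*} [Fintype ι] (b : OrthonormalBasis ι ℂ H) (T : H →L[ℂ] H) :
    opTrace T = ∑ i, ⟪b i, T (b i)⟫_ℂ :=
  LinearMap.trace_eq_sum_inner (T : H →ₗ[ℂ] H) b

theorem opTrace_mul_comm (S T : H →L[ℂ] H) : opTrace (S * T) = opTrace (T * S) :=
  LinearMap.trace_mul_comm ℂ (S : H →ₗ[ℂ] H) T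

theorem opTrace_sum {ι : Type*} [Fintype ι] (T : ι → (H →L[ℂ] H)) :
    opTrace (∑ i, T i) = ∑ i, opTrace (T i) := by
  simp [opTrace]

theorem opTrace_smul (c : ℂ) (T : H →L[ℂ] H) : opTrace (c • T) = c * opTrace T := by
  simp [opTrace]

/-- The trace pairing separates operators. -/
theorem ext_of_opTrace_mul [FiniteDimensional ℂ H] {C D : H →L[ℂ] H}
    (h : ∀ T, opTrace (T * C) = opTrace (T * D)) : C = D := by
  apply ContinuousLinearMap.coe_injective
  refine (ext_inner_map _ _).1 fun x => ?_
  have key (C : H →L[ℂ] H) : opTrace (InnerProductSpace.rankOne ℂ x x * C) = ⟪x, C x⟫_ℂ := by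
    rw [opTrace_mul_comm, ContinuousLinearMap.mul_def, InnerProductSpace.comp_rankOne]
    exact InnerProductSpace.trace_rankOne _ _
  have := h (InnerProductSpace.rankOne ℂ x x)
  rw [key, key] at this
  rw [← inner_conj_symm, ← inner_conj_symm (D.toLinearMap x)]
  exact congrArg _ this

variable [CompleteSpace H]

theorem eq_zero_of_opTrace_eq_zero [FiniteDimensional ℂ H] {T : H →L[ℂ] H} (hT : 0 ≤ T)
    (h : opTrace T = 0) : T = 0 := by
  obtain ⟨S, rfl⟩ := CStarAlgebra.nonneg_iff_eq_star_mul_self.1 hT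
  let b := stdOrthonormalBasis ℂ H
  have hn (i) : ⟪b i, (star S * S) (b i)⟫_ℂ = ((‖S (b i)‖ ^ 2 : ℝ) : ℂ) := by
    simp [ContinuousLinearMap.star_eq_adjoint, ContinuousLinearMap.adjoint_inner_right]
  rw [opTrace_eq_sum_inner b, Finset.sum_congr rfl fun i _ => hn i] at h
  norm_cast at h
  rw [Finset.sum_eq_zero_iff_of_nonneg (fun _ _ => by positivity)] at h
  have : S = 0 := by
    apply ContinuousLinearMap.coe_injective
    apply b.toBasis.ext
    intro i
    simpa using h i (Finset.mem_univ _)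
  simp [this]

/-- An operation `Φ` that measures the effect `E` vanishes at `s* s` if `s E = 0`. -/
theorem map_star_mul_self_eq_zero_of_mul_eq_zero {K : Type*}
    [NormedAddCommGroup K] [InnerProductSpace ℂ K] [FiniteDimensional ℂ K] [CompleteSpace K]
    {Φ : (H →L[ℂ] H) →CP (K →L[ℂ] K)} {E : H →L[ℂ] H}
    (hE : ∀ T, opTrace (T * E) = opTrace (Φ T)) {s : H →L[ℂ] H} (hs : s * E = 0) :
    Φ (star s * s) = 0 :=
  eq_zero_of_opTrace_eq_zero (map_nonneg Φ (star_mul_self_nonneg s)) <| by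
    rw [← hE, mul_assoc, hs, mul_zero]; simp [opTrace]

end Trace

/-! ### Simulation by a single observable -/

section Simulability

variable {H : Type*} [NormedAddCommGroup H] [InnerProductSpace ℂ H] [FiniteDimensional ℂ H]

/-- Post-processings of a single observable are closed under convex combinations. -/
theorem mem_simO_singleton {A B : Observable H} : A ∈ simO {B} ↔ PostProcessing A B := by
  constructor
  · intro h
    obtain ⟨n, C, μ, t, hC, hμ, ht, ht1, hA⟩ := h A rfl
    have key (D : Observable H) (hD : D ∈ ({B} : Set (Observable H))) (ν : A.Ω → D.Ω → ℝ)
        (hν : IsStochastic ν) :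
        ∃ ν' : A.Ω → B.Ω → ℝ, IsStochastic ν' ∧ ∀ ω', postProcess D ν ω' = postProcess B ν' ω' := by
      rcases hD with rfl
      exact ⟨ν, hν, fun _ => rfl⟩
    choose ν hν hν' using fun i => key (C i) (hC i) (μ i) (hμ i)
    refine ⟨fun ω' ω => ∑ i, t i * ν i ω' ω, ⟨fun ω' ω => ?_, fun ω => ?_⟩, fun ω' => ?_⟩
    · exact Finset.sum_nonneg fun i _ => mul_nonneg (ht i).1 ((hν i).1 ω' ω)
    · rw [Finset.sum_comm]
      simp [← Finset.mul_sum, (hν _).2, ht1]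
    · simp only [hA, hν']
      simp only [postProcess, Finset.smul_sum, smul_smul, Complex.ofReal_sum,
        Complex.ofReal_mul, Finset.sum_smul]
      exact Finset.sum_comm
  · rintro ⟨μ, hμ, hA⟩ A' rfl
    exact ⟨1, fun _ => B, fun _ => μ, fun _ => 1, by simp, fun _ => hμ, by simp, by simp,
      by simpa using hA⟩

end Simulability

/-! ### The projections onto the vectors of a basis -/

section Basis

variable (b : OrthonormalBasis (Fin 3) ℂ Qutrit)

theorem star_basisProj (n : Fin 3) : star (basisProj b n) = basisProj b n :=
  (basisProj_isPositive b n).isSelfAdjoint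

theorem basisProj_mul_basisProj (m n : Fin 3) :
    basisProj b m * basisProj b n = if m = n then basisProj b n else 0 := by
  ext1 x
  simp only [basisProj, mul_apply_eq_comp, InnerProductSpace.rankOne_apply, map_smul,
    b.inner_eq_ite]
  split_ifs with h <;> simp [h]

theorem basisProj_apply_basis (m n : Fin 3) :
    basisProj b m (b n) = if m = n then b n else 0 := by
  simp only [basisProj, InnerProductSpace.rankOne_apply, b.inner_eq_ite]
  split_ifs with h <;> simp [h]

theorem basisProj_mul_self_mul (T : Qutrit →L[ℂ] Qutrit) (n : Fin 3) :
    basisProj b n * T * basisProj b n = ⟪b n, T (b n)⟫_ℂ • basisProj b n := by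
  ext1 x
  simp [basisProj, smul_smul, mul_comm]

theorem opTrace_basisProj_mul_self_mul (T : Qutrit →L[ℂ] Qutrit) (n : Fin 3) :
    opTrace (basisProj b n * T * basisProj b n) = opTrace (T * basisProj b n) := by
  rw [opTrace_mul_comm, ← mul_assoc, basisProj_mul_basisProj, if_pos rfl, opTrace_mul_comm]

theorem eq_sum_basisProj (T : Qutrit →L[ℂ] Qutrit) :
    T = ∑ m, ∑ n, basisProj b m * T * basisProj b n := by
  simp_rw [← Finset.mul_sum, basisProj_sum, mul_one, ← Finset.sum_mul, basisProj_sum, one_mul]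

/-! ### Post-processings of the basis observable -/

theorem postProcessing_obsA : PostProcessing (obsA b) (obsE b) := by
  have h₁ : IsStochastic (Ω' := Fin 2) (Ω := Fin 3) ![![1, 0, 0], ![0, 1, 1]] :=
    ⟨by simp [Fin.forall_fin_succ], by simp [Fin.forall_fin_succ]⟩
  have hz (n : Fin 3) : (0 : ℂ) • basisProj b n = 0 := zero_smul ℂ (basisProj b n)
  have h₂ (i : Fin 2) : ![basisProj b 0, basisProj b 1 + basisProj b 2] i =
      ∑ j : Fin 3, (((![![1, 0, 0], ![0, 1, 1]] : Fin 2 → Fin 3 → ℝ) i j : ℝ) : ℂ) •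
        basisProj b j := by
    fin_cases i <;> simp [Fin.sum_univ_three, hz]
  exact ⟨_, h₁, h₂⟩

theorem postProcessing_obsB : PostProcessing (obsB b) (obsE b) := by
  have h₁ : IsStochastic (Ω' := Fin 2) (Ω := Fin 3) ![![1, 1, 0], ![0, 0, 1]] :=
    ⟨by simp [Fin.forall_fin_succ], by simp [Fin.forall_fin_succ]⟩
  have hz (n : Fin 3) : (0 : ℂ) • basisProj b n = 0 := zero_smul ℂ (basisProj b n)
  have h₂ (i : Fin 2) : ![basisProj b 0 + basisProj b 1, basisProj b 2] i =
      ∑ j : Fin 3, (((![![1, 1, 0], ![0, 0, 1]] : Fin 2 → Fin 3 → ℝ) i j : ℝ) : ℂ) •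
        basisProj b j := by
    fin_cases i <;> simp [Fin.sum_univ_three, hz]
  exact ⟨_, h₁, h₂⟩

theorem postProcessing_refl_obsE : PostProcessing (obsE b) (obsE b) := by
  have h₁ : IsStochastic (Ω' := Fin 3) (Ω := Fin 3) fun i j => if i = j then 1 else 0 :=
    ⟨fun i j => by positivity, by simp⟩
  have h₂ (i : Fin 3) :
      basisProj b i = ∑ j, (((if i = j then 1 else 0 : ℝ)) : ℂ) • basisProj b j := by
    have h (j : Fin 3) : (((if i = j then 1 else 0 : ℝ)) : ℂ) • basisProj b j =
        if i = j then basisProj b j else 0 := by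
      split_ifs
      · rw [Complex.ofReal_one, one_smul]
      · rw [Complex.ofReal_zero]
        exact zero_smul ℂ (basisProj b j)
    simp [h]
  exact ⟨_, h₁, h₂⟩

/-! ### Channels compatible with both coarse-grainings -/

/-- A channel compatible with `A` erases the coherence between the `m`-th and the `n`-th basis
vector as soon as each effect of `A` is annihilated by one of the two projections. -/
theorem map_basisProj_mul_mul_eq_zero {A : Observable Qutrit} {Λ : Channel Qutrit}
    (h : Compatible A Λ) {m n : Fin 3}
    (hmn : ∀ ω, basisProj b m * A.effect ω = 0 ∨ basisProj b n * A.effect ω = 0)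
    (T : Qutrit →L[ℂ] Qutrit) : Λ.map (basisProj b m * T * basisProj b n) = 0 := by
  obtain ⟨I, hI, hA⟩ := h
  rw [← hI]
  refine Finset.sum_eq_zero fun ω _ => ?_
  rcases hmn ω with h | h
  · have := map_star_mul_eq_zero _ (map_star_mul_self_eq_zero_of_mul_eq_zero (hA ω) h)
      (T * basisProj b n)
    rwa [star_basisProj, ← mul_assoc] at this
  · exact map_mul_eq_zero _ (map_star_mul_self_eq_zero_of_mul_eq_zero (hA ω) h) (basisProj b m * T)

/-- `A` separates the first index from the others and `B` separates the last one, so all coherences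
are erased. -/
theorem channel_eq_pinched {Λ : Channel Qutrit} (hA : Compatible (obsA b) Λ)
    (hB : Compatible (obsB b) Λ) (T : Qutrit →L[ℂ] Qutrit) :
    Λ.map T = ∑ n, Λ.map (basisProj b n * T * basisProj b n) := by
  have hA0 (m n : Fin 3) (h : m = 0 ∧ n ≠ 0 ∨ m ≠ 0 ∧ n = 0) :
      Λ.map (basisProj b m * T * basisProj b n) = 0 := by
    have key (ω : Fin 2) : basisProj b m * ![basisProj b 0, basisProj b 1 + basisProj b 2] ω = 0 ∨
        basisProj b n * ![basisProj b 0, basisProj b 1 + basisProj b 2] ω = 0 := by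
      fin_cases ω <;> fin_cases m <;> fin_cases n <;>
        simp [mul_add, basisProj_mul_basisProj] at h ⊢
    exact map_basisProj_mul_mul_eq_zero b hA key T
  have hB0 (m n : Fin 3) (h : m = 2 ∧ n ≠ 2 ∨ m ≠ 2 ∧ n = 2) :
      Λ.map (basisProj b m * T * basisProj b n) = 0 := by
    have key (ω : Fin 2) : basisProj b m * ![basisProj b 0 + basisProj b 1, basisProj b 2] ω = 0 ∨
        basisProj b n * ![basisProj b 0 + basisProj b 1, basisProj b 2] ω = 0 := by
      fin_cases ω <;> fin_cases m <;> fin_cases n <;>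
        simp [mul_add, basisProj_mul_basisProj] at h ⊢
    exact map_basisProj_mul_mul_eq_zero b hB key T
  conv_lhs => rw [eq_sum_basisProj b T, map_sum]
  refine Finset.sum_congr rfl fun m _ => ?_
  rw [map_sum]
  refine Finset.sum_eq_single_of_mem m (Finset.mem_univ m) fun n _ hn => ?_
  by_cases h0 : m = 0 ∧ n ≠ 0 ∨ m ≠ 0 ∧ n = 0
  · exact hA0 m n h0
  · exact hB0 m n (by omega)

/-- A channel that ignores coherences can be preceded by a measurement of the basis observable,
whose outcomes are then processed at will. -/
theorem compatible_of_pinched {Λ : Channel Qutrit}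
    (hΛ : ∀ T, Λ.map T = ∑ n, Λ.map (basisProj b n * T * basisProj b n))
    {C : Observable Qutrit} (hC : PostProcessing C (obsE b)) : Compatible C Λ := by
  obtain ⟨ν, hν, hC⟩ := hC
  have hsum (T : Qutrit →L[ℂ] Qutrit) :
      ∑ ω, weightedCompression Λ.map (ν ω) (hν.1 ω) (basisProj b) T = Λ.map T := by
    change ∑ ω, ∑ n : Fin 3, (ν ω n : ℂ) • Λ.map (star (basisProj b n) * T * basisProj b n) = _
    rw [Finset.sum_comm, hΛ T]
    refine Finset.sum_congr rfl fun n _ => ?_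
    have hn : ∑ ω, ν ω n = 1 := hν.2 n
    rw [← Finset.sum_smul, star_basisProj, ← Complex.ofReal_sum, hn, Complex.ofReal_one, one_smul]
  refine ⟨⟨fun ω => weightedCompression Λ.map (ν ω) (hν.1 ω) (basisProj b), fun T => ?_⟩, hsum,
    fun ω T => ?_⟩
  · rw [hsum, Λ.trace_map]
  · change _ = opTrace (∑ n : Fin 3, (ν ω n : ℂ) • Λ.map (star (basisProj b n) * T * basisProj b n))
    have : C.effect ω = ∑ n : Fin 3, (ν ω n : ℂ) • basisProj b n := hC ω
    rw [this, Finset.mul_sum, opTrace_sum, opTrace_sum]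
    refine Finset.sum_congr rfl fun n _ => ?_
    rw [mul_smul_comm, opTrace_smul, opTrace_smul, Λ.trace_map, star_basisProj,
      opTrace_basisProj_mul_self_mul]

/-! ### The Lüders channel -/

/-- The Lüders channel `T ↦ ∑ n, |n⟩⟨n| T |n⟩⟨n|` of a basis, a weighted compression of the identity
map with unit weights. -/
noncomputable def luedersChannel : Channel Qutrit where
  K := Qutrit
  map := weightedCompression
    (CompletelyPositiveMapClass.toCompletelyPositiveLinearMap
      (NonUnitalStarAlgHom.id ℂ (Qutrit →L[ℂ] Qutrit)))
    (fun _ => 1) (fun _ => zero_le_one) (basisProj b)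
  trace_map T := by
    change opTrace (∑ n : Fin 3, ((1 : ℝ) : ℂ) • (star (basisProj b n) * T * basisProj b n)) = _
    simp only [Complex.ofReal_one, one_smul, star_basisProj, opTrace_sum,
      opTrace_basisProj_mul_self_mul]
    rw [← opTrace_sum, ← Finset.mul_sum, basisProj_sum, mul_one]

theorem luedersChannel_map (T : Qutrit →L[ℂ] Qutrit) :
    (luedersChannel b).map T = ∑ n, basisProj b n * T * basisProj b n := by
  change ∑ n : Fin 3, ((1 : ℝ) : ℂ) • (star (basisProj b n) * T * basisProj b n) = _
  simp [star_basisProj]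

theorem luedersChannel_pinched (T : Qutrit →L[ℂ] Qutrit) :
    (luedersChannel b).map T =
      ∑ n, (luedersChannel b).map (basisProj b n * T * basisProj b n) := by
  simp only [luedersChannel_map]
  refine Finset.sum_congr rfl fun n _ => ?_
  have h (m : Fin 3) : basisProj b m * (basisProj b n * T * basisProj b n) * basisProj b m =
      if m = n then basisProj b n * T * basisProj b n else 0 := by
    rw [← mul_assoc, ← mul_assoc, basisProj_mul_basisProj]
    split_ifs with h
    · rw [h, mul_assoc, basisProj_mul_basisProj, if_pos rfl]
    · simp only [zero_mul]
  rw [Finset.sum_congr rfl fun m _ => h m, Finset.sum_ite_eq' Finset.univ n,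
    if_pos (Finset.mem_univ n)]

/-- Only post-processings of the basis observable are compatible with its Lüders channel. -/
theorem postProcessing_of_compatible_luedersChannel {C : Observable Qutrit}
    (h : Compatible C (luedersChannel b)) : PostProcessing C (obsE b) := by
  obtain ⟨I, hI, hC⟩ := h
  -- The same operations, with the output space of the channel unfolded to `Qutrit`.
  let I' (ω : C.Ω) : (Qutrit →L[ℂ] Qutrit) →CP (Qutrit →L[ℂ] Qutrit) := I.op ω
  replace hI (T) : ∑ ω, I' ω T = ∑ n, basisProj b n * T * basisProj b n :=
    (hI T).trans (luedersChannel_map b T)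
  -- `f ω n` is the functional `T ↦ ⟨n| I_ω(T) |n⟩`.
  let f (ω : C.Ω) (n : Fin 3) := vectorFunctional (I' ω) (b n)
  have hf_sum (n m : Fin 3) : ∑ ω, f ω n (basisProj b m) = if m = n then 1 else 0 := by
    have h1 : ∑ ω, f ω n (basisProj b m) = ⟪b n, (∑ ω, I' ω (basisProj b m)) (b n)⟫_ℂ := by
      rw [sum_apply, inner_sum]
      rfl
    have h2 (k : Fin 3) : ⟪b n, (basisProj b k * basisProj b m * basisProj b k) (b n)⟫_ℂ =
        if k = n then (if m = n then 1 else 0) else 0 := by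
      simp only [mul_apply_eq_comp, basisProj_apply_basis]
      split_ifs <;> simp_all [basisProj_apply_basis]
    rw [h1, hI, sum_apply, inner_sum, Finset.sum_congr rfl fun k _ => h2 k]
    simp
  have hf_nonneg (ω n m) : 0 ≤ f ω n (basisProj b m) :=
    map_nonneg (f ω n) ((ContinuousLinearMap.nonneg_iff_isPositive _).2 (basisProj_isPositive b m))
  have hf_zero (ω n m) (hmn : m ≠ n) : f ω n (basisProj b m) = 0 := by
    have := hf_sum n m
    rw [if_neg hmn, Finset.sum_eq_zero_iff_of_nonneg fun ω _ => hf_nonneg ω n m] at this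
    exact this ω (Finset.mem_univ _)
  -- By Cauchy–Schwarz, `f ω n` sees only the compression of `T` to the `n`-th basis vector.
  have hf (ω n T) : f ω n T = ⟪b n, T (b n)⟫_ℂ * f ω n (basisProj b n) := by
    have hl (m) (hm : m ≠ n) (T) : f ω n (basisProj b m * T) = 0 := by
      have := functional_star_mul_eq_zero (f ω n) (s := basisProj b m)
        (by rw [star_basisProj, basisProj_mul_basisProj, if_pos rfl, hf_zero ω n m hm]) T
      rwa [star_basisProj] at this
    have hr (m) (hm : m ≠ n) (T) : f ω n (T * basisProj b m) = 0 := by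
      have := hl m hm (star T)
      rw [← star_basisProj, ← star_mul, map_star] at this
      simpa using this
    conv_lhs => rw [eq_sum_basisProj b T, map_sum]
    rw [Finset.sum_eq_single_of_mem n (Finset.mem_univ n), map_sum,
      Finset.sum_eq_single_of_mem n (Finset.mem_univ n), basisProj_mul_self_mul, map_smul,
      smul_eq_mul]
    · exact fun m _ hm => hr m hm _
    · intro m _ hm
      rw [map_sum]
      exact Finset.sum_eq_zero fun k _ => by rw [mul_assoc]; exact hl m hm _
  have hre (ω n) : ((f ω n (basisProj b n)).re : ℂ) = f ω n (basisProj b n) :=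
    (Complex.eq_re_of_ofReal_le (r := 0) (by simpa using hf_nonneg ω n n)).symm
  refine ⟨fun ω n => (f ω n (basisProj b n)).re, ⟨fun ω n => ?_, fun n => ?_⟩, fun ω => ?_⟩
  · exact (Complex.le_def.1 (hf_nonneg ω n n)).1
  · change Fin 3 at n
    change ∑ ω, (f ω n (basisProj b n)).re = 1
    rw [← Complex.re_sum, hf_sum, if_pos rfl, Complex.one_re]
  · refine ext_of_opTrace_mul fun T => ?_
    rw [hC]
    change opTrace (I' ω T) = opTrace (T * ∑ n : Fin 3, _ • basisProj b n)
    rw [opTrace_eq_sum_inner b, Finset.mul_sum, opTrace_sum]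
    refine Finset.sum_congr rfl fun n _ => ?_
    rw [hre, mul_smul_comm, opTrace_smul, ← opTrace_basisProj_mul_self_mul, basisProj_mul_self_mul,
      opTrace_smul]
    have h1 : opTrace (basisProj b n) = 1 := by
      refine (InnerProductSpace.trace_rankOne (𝕜 := ℂ) (b n) (b n)).trans ?_
      simp
    rw [h1, mul_one, mul_comm]
    exact hf ω n T

/-! ### Leaked and simulable observables -/

theorem leak_obsA_obsB : leak {obsA b, obsB b} = simO {obsE b} := by
  ext C
  rw [mem_simO_singleton]
  constructor
  · intro h
    refine postProcessing_of_compatible_luedersChannel b (h _ ?_)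
    rintro D (rfl | rfl)
    · exact compatible_of_pinched b (luedersChannel_pinched b) (postProcessing_obsA b)
    · exact compatible_of_pinched b (luedersChannel_pinched b) (postProcessing_obsB b)
  · intro h Λ hΛ
    exact compatible_of_pinched b
      (channel_eq_pinched b (hΛ _ (Or.inl rfl)) (hΛ _ (Or.inr rfl))) h

/-- The middle effect of `E` violates the inequality `⟨2|F|2⟩ ≤ ⟨1|F|1⟩ + ⟨3|F|3⟩` obeyed by all
effects that `A` and `B` simulate. -/
theorem obsE_notMem_simO : obsE b ∉ simO {obsA b, obsB b} := by
  intro h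
  obtain ⟨k, D, μ, t, hD, hμ, ht, -, hE⟩ := h _ rfl
  -- `w T n` is the diagonal entry `⟨n| T |n⟩`.
  let w (T : Qutrit →L[ℂ] Qutrit) (n : Fin 3) : ℝ := (⟪b n, T (b n)⟫_ℂ).re
  have key (D : Observable Qutrit) (hD : D ∈ ({obsA b, obsB b} : Set _)) (μ : Fin 3 → D.Ω → ℝ)
      (hμ : ∀ i j, 0 ≤ μ i j) :
      w (postProcess D μ 1) 1 ≤ w (postProcess D μ 1) 0 + w (postProcess D μ 1) 2 := by
    rcases hD with rfl | rfl
    · have : postProcess (obsA b) μ 1 = (μ 1 (0 : Fin 2) : ℂ) • basisProj b 0 +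
          (μ 1 (1 : Fin 2) : ℂ) • (basisProj b 1 + basisProj b 2) := Fin.sum_univ_two _
      rw [this]
      simpa [w, basisProj_apply_basis] using hμ 1 (0 : Fin 2)
    · have : postProcess (obsB b) μ 1 = (μ 1 (0 : Fin 2) : ℂ) • (basisProj b 0 + basisProj b 1) +
          (μ 1 (1 : Fin 2) : ℂ) • basisProj b 2 := Fin.sum_univ_two _
      rw [this]
      simpa [w, basisProj_apply_basis] using hμ 1 (1 : Fin 2)
  have hw (n : Fin 3) :
      w (basisProj b 1) n = ∑ i, t i * w (postProcess (D i) (μ i) (1 : Fin 3)) n := by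
    have : basisProj b 1 = _ := hE (1 : Fin 3)
    rw [this]
    have key : ⟪b n, (∑ i, (t i : ℂ) • postProcess (D i) (μ i) (1 : Fin 3)) (b n)⟫_ℂ =
        ∑ i, (t i : ℂ) * ⟪b n, postProcess (D i) (μ i) (1 : Fin 3) (b n)⟫_ℂ := by
      rw [sum_apply, inner_sum]
      exact Finset.sum_congr rfl fun i _ => inner_smul_right _ _ _
    simp only [w]
    rw [key, Complex.re_sum]
    simp only [Complex.re_ofReal_mul]
  have h01 : w (basisProj b 1) 0 = 0 := by simp [w, basisProj_apply_basis]
  have h11 : w (basisProj b 1) 1 = 1 := by simp [w, basisProj_apply_basis]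
  have h21 : w (basisProj b 1) 2 = 0 := by simp [w, basisProj_apply_basis]
  have : w (basisProj b 1) 1 ≤ w (basisProj b 1) 0 + w (basisProj b 1) 2 := by
    rw [hw, hw, hw, ← Finset.sum_add_distrib]
    refine Finset.sum_le_sum fun i _ => ?_
    rw [← mul_add]
    exact mul_le_mul_of_nonneg_left (key (D i) (hD i) (μ i) (hμ i).1) (ht i).1
  rw [h01, h11, h21] at this
  norm_num at this

theorem jointlyMeasurable_obsA_obsB : JointlyMeasurable {obsA b, obsB b} := by
  refine ⟨obsE b, ?_⟩
  rintro D (rfl | rfl)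
  exacts [postProcessing_obsA b, postProcessing_obsB b]

theorem simO_obsE_ne : simO {obsE b} ≠ simO {obsA b, obsB b} := by
  intro h
  apply obsE_notMem_simO b
  rw [← h, mem_simO_singleton]
  exact postProcessing_refl_obsE b

end Basis

end QLeak

theorem mainTheorem7 :
    (∀ b : OrthonormalBasis (Fin 3) ℂ QLeak.Qutrit,
      QLeak.JointlyMeasurable {QLeak.obsA b, QLeak.obsB b} ∧
      QLeak.leak {QLeak.obsA b, QLeak.obsB b} = QLeak.simO {QLeak.obsE b} ∧
      QLeak.simO {QLeak.obsE b} ≠ QLeak.simO {QLeak.obsA b, QLeak.obsB b}) ∧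
    ¬ ∀ X : Set (QLeak.Observable QLeak.Qutrit),
      QLeak.JointlyMeasurable X → QLeak.leak X = QLeak.simO X := by
  refine ⟨fun b => ⟨QLeak.jointlyMeasurable_obsA_obsB b, QLeak.leak_obsA_obsB b,
    QLeak.simO_obsE_ne b⟩, fun h => ?_⟩
  let b := EuclideanSpace.basisFun (Fin 3) ℂ
  exact QLeak.simO_obsE_ne b
    ((QLeak.leak_obsA_obsB b).symm.trans (h _ (QLeak.jointlyMeasurable_obsA_obsB b)))
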